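/- Let $f:\mathbb{R}^d\to\mathbb{R}$ be continuously differentiable and bounded below, and suppose that for some $\alpha\in(0,1]$ and $A>0$ one has $\|\nabla f(x)-\nabla f(y)\|\le A\|x-y\|^{\alpha}$ for all $x,y\in\mathbb{R}^d$ (Euclidean norm). Let $(\xi_t)_{t\ge 0}$ be mutually independent random variables on a probability space with values in a measurable space $S$, and let $g:\mathbb{R}^d\times S\to\mathbb{R}^d$ be measurable and such that, for all $t\ge 0$ and $x\in\mathbb{R}^d$, $g(x,\xi_t)$ is integrable with $\mathbb{E}[g(x,\xi_t)]=\nabla f(x)$. Let $0\le\beta<1$, $0\le\beta'<1$, $\kappa>0$, $x_0\in\mathbb{R}^d$, and $$\frac{1}{1+\alpha}-\frac12<\epsilon\le\frac12 .$$ Consider the perturbed Adam algorithm: $v_0=0$, $m_0=0$ and, for $t\ge 0$, with $g_t=g(x_t,\xi_t)$, $$m_{t+1}=\beta m_t-\frac{1-\beta}{(t+1)^{1/2+\epsilon}\,(\kappa+\sqrt{v_t})}\,g_t,\qquad x_{t+1}=x_t+m_{t+1},\qquad v_{t+1}=\beta' v_t+(1-\beta')\|g_t\|^2 ,$$ so that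 $v_t$ depends only on the gradients observed in steps $0,\dots,t-1$. Assume that there is a constant $G>0$ such that, almost surely, $\|\nabla f(x_t)\|\le G$ and $\|g_t\|\le G$ for all $t\ge 0$. Then, almost surely, $\nabla f(x_t)\to 0$ as $t\to\infty$, the sequence $f(x_t)$ converges to a finite limit, and $$\liminf_{t\to\infty}\; t^{1/2-\epsilon}\,\|\nabla f(x_t)\|^2=0 .$$ -/

import Mathlib

open MeasureTheory ProbabilityTheory Filter
open scoped Topology

namespace PerturbedAdam

/-- The hyperparameters of the algorithm. The admissible ranges
(`0 ≤ β < 1`, `0 ≤ β' < 1`, `0 < κ`) are hypotheses of the theorem. -/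
structure Params where
  /-- momentum factor -/
  β : ℝ
  /-- averaging factor of the squared gradient norms -/
  β' : ℝ
  /-- numerical stability constant -/
  κ : ℝ
  /-- stepsize exponent offset -/
  ε : ℝ

/-- The state `(v_t, m_t, x_t)` of the algorithm before iteration `t`. -/
structure State (d : ℕ) where
  /-- weighted average of the squared norms of the gradients observed before iteration `t` -/
  v : ℝ
  /-- momentum -/
  m : EuclideanSpace ℝ (Fin d)
  /-- iterate -/
  x : EuclideanSpace ℝ (Fin d)

/-- The stepsize `(1 - β) / ((t + 1) ^ (1/2 + ε) * (κ + √v))`. -/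
noncomputable def stepsize (p : Params) (t : ℕ) (v : ℝ) : ℝ :=
  (1 - p.β) / (((t : ℝ) + 1) ^ ((1 : ℝ) / 2 + p.ε) * (p.κ + Real.sqrt v))

/-- The algorithm run on the noise sequence `ξ 0, ξ 1, …` with oracle `g`, from the point `x₀`
and `v_0 = 0`, `m_0 = 0`. In iteration `t`, with `g_t = g (x_t, ξ_t)`,
`m_{t+1} = β m_t - γ_t g_t` where `γ_t = stepsize p t v_t`, `x_{t+1} = x_t + m_{t+1}`,
and `v_{t+1} = β' v_t + (1 - β') ‖g_t‖ ^ 2`. -/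
noncomputable def run {d : ℕ} {S : Type*} (p : Params)
    (g : EuclideanSpace ℝ (Fin d) → S → EuclideanSpace ℝ (Fin d))
    (x₀ : EuclideanSpace ℝ (Fin d)) (ξ : ℕ → S) : ℕ → State d
  | 0 => { v := 0, m := 0, x := x₀ }
  | t + 1 =>
    let s := run p g x₀ ξ t
    let gt := g s.x (ξ t)
    let m' := p.β • s.m - stepsize p t s.v • gt
    { v := p.β' * s.v + (1 - p.β') * ‖gt‖ ^ 2
      m := m'
      x := s.x + m' }

/-- The iterate `x_t` as a random vector, for a random noise sequence `ξ`. -/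
noncomputable def iterate {d : ℕ} {S Ω : Type*} (p : Params)
    (g : EuclideanSpace ℝ (Fin d) → S → EuclideanSpace ℝ (Fin d))
    (x₀ : EuclideanSpace ℝ (Fin d)) (ξ : ℕ → Ω → S) (t : ℕ) (ω : Ω) :
    EuclideanSpace ℝ (Fin d) :=
  (run p g x₀ (fun i => ξ i ω) t).x

end PerturbedAdam

/-! Put `q = 1/2 + ε` and `w t = (t + 1) ^ (-q)`. Bounded gradients keep `v` in `[0, G ^ 2]`, so the
stepsizes lie between two multiples of `w`. The shifted point `z = x + β / (1 - β) • m` moves by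
plain gradient steps `-(γ / (1 - β)) • g`, and a Taylor estimate makes `f (z t)` decrease by a
multiple of `γ t * ‖∇f (x t)‖ ^ 2`, up to noise and an error `O(w t ^ (1 + α))`. The errors are
summable because `q * (1 + α) > 1`. As `v t` involves past gradients only, the noise terms are
martingale differences of size `O(w t)`; their series converges because `2 * q > 1`. Hence `f (z t)`
converges and `∑ w t * ‖∇f (x t)‖ ^ 2` is finite. Since `‖m t‖ = O(w t)`, `f (x t)` has the same
limit, and the variation of the gradient is Hölder-controlled by sums of `w`. As `∑ w` diverges (`q
≤ 1`), the gradient tends to zero; comparison with the harmonic series gives the rate. -/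

namespace PerturbedAdam

/-! ### Martingale convergence of the noise. -/

section Probability

/-- If `ξ` is independent of `X` and every section of `φ` has mean zero, so has `φ (X, ξ)`. -/
theorem integral_comp_prodMk_eq_zero {Ω 𝓧 S : Type*} {_ : MeasurableSpace Ω}
    {_ : MeasurableSpace 𝓧} {_ : MeasurableSpace S} {μ : Measure Ω} [IsProbabilityMeasure μ]
    {X : Ω → 𝓧} {ξ : Ω → S} (hX : Measurable X) (hξ : Measurable ξ) (hind : IndepFun X ξ μ)
    {φ : 𝓧 × S → ℝ} (hφ : Measurable φ) (hzero : ∀ x, ∫ ω, φ (x, ξ ω) ∂μ = 0) :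
    ∫ ω, φ (X ω, ξ ω) ∂μ = 0 := by
  have hprod := (indepFun_iff_map_prod_eq_prod_map_map hX.aemeasurable hξ.aemeasurable).1 hind
  have := Measure.isProbabilityMeasure_map (μ := μ) hX.aemeasurable
  have := Measure.isProbabilityMeasure_map (μ := μ) hξ.aemeasurable
  rw [← integral_map (φ := fun ω => (X ω, ξ ω)) (hX.prodMk hξ).aemeasurable
    hφ.aestronglyMeasurable, hprod]
  by_cases hint : Integrable φ ((μ.map X).prod (μ.map ξ))
  · rw [integral_prod _ hint]
    refine integral_eq_zero_of_ae (Eventually.of_forall fun x => ?_)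
    have hx : Measurable fun s => φ (x, s) := hφ.comp measurable_prodMk_left
    simp only [Pi.zero_apply]
    rw [integral_map hξ.aemeasurable hx.aestronglyMeasurable, hzero]
  -- A non-integrable function has integral `0` by convention.
  · exact integral_undef hint

theorem measurable_indicator_fst_mul {𝓧 S : Type*} {_ : MeasurableSpace 𝓧}
    {_ : MeasurableSpace S} {s : Set 𝓧} (hs : MeasurableSet s) {φ : 𝓧 × S → ℝ}
    (hφ : Measurable φ) : Measurable fun p : 𝓧 × S => s.indicator 1 p.1 * φ p :=
  ((measurable_one.indicator hs).comp measurable_fst).mul hφ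

/-- If `ξ` is independent of the σ-algebra `m` and every section of the `m`-measurable kernel `φ`
has mean zero, then `φ (ω, ξ ω)` has zero conditional expectation given `m`. -/
theorem condExp_kernel_eq_zero {Ω S : Type*} {m m0 : MeasurableSpace Ω} {mS : MeasurableSpace S}
    {μ : Measure Ω} [IsProbabilityMeasure μ] (hm : m ≤ m0) {ξ : Ω → S} (hξ : Measurable[m0] ξ)
    (hind : Indep m (MeasurableSpace.comap ξ inferInstance) μ)
    {φ : Ω × S → ℝ} (hφ : Measurable[m.prod inferInstance] φ)
    (hint : Integrable (fun ω => φ (ω, ξ ω)) μ) (hzero : ∀ x, ∫ ω, φ (x, ξ ω) ∂μ = 0) :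
    μ[fun ω => φ (ω, ξ ω) | m] =ᵐ[μ] 0 := by
  symm
  refine ae_eq_condExp_of_forall_setIntegral_eq hm hint (fun s _ _ => integrableOn_zero)
    (fun s hs _ => ?_) aestronglyMeasurable_zero
  -- The identity, seen as a map from `m0` to `m`, is a random variable generating `m`; multiplying
  -- `φ` by the indicator of `s` keeps its sections centred.
  have hid : @Measurable Ω Ω m0 m id := measurable_id'' hm
  have hind' : @IndepFun Ω Ω S m0 m _ id ξ μ :=
    (@IndepFun_iff_Indep Ω Ω S m0 m mS id ξ μ).2 (by rw [MeasurableSpace.comap_id]; exact hind)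
  have hset : Measurable[m.prod inferInstance] (fun p : Ω × S => s.indicator 1 p.1 * φ p) :=
    measurable_indicator_fst_mul hs hφ
  have key := @integral_comp_prodMk_eq_zero Ω Ω S m0 m mS μ _ id ξ hid hξ hind' _ hset
    (fun x => by simp only [integral_const_mul, hzero, mul_zero])
  rw [← integral_indicator (hm s hs), ← integral_indicator (hm s hs)]
  simp only [Set.indicator_zero', Pi.zero_apply, integral_zero]
  rw [← key]
  congr 1
  ext ω
  by_cases h : ω ∈ s <;> simp [h]

/-- A series of martingale differences with square-summable almost sure bounds converges almost
surely. -/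
theorem ae_exists_tendsto_sum_of_condExp_eq_zero {Ω : Type*} {m0 : MeasurableSpace Ω}
    {μ : Measure Ω} [IsProbabilityMeasure μ] (ℱ : Filtration ℕ m0) {Y : ℕ → Ω → ℝ} {c : ℕ → ℝ}
    (hY : ∀ n, StronglyMeasurable[ℱ (n + 1)] (Y n)) (hbound : ∀ n, ∀ᵐ ω ∂μ, |Y n ω| ≤ c n)
    (hc : Summable fun n => c n ^ 2) (hcond : ∀ n, μ[Y n | ℱ n] =ᵐ[μ] 0) :
    ∀ᵐ ω ∂μ, ∃ L : ℝ, Tendsto (fun n => ∑ s ∈ Finset.range n, Y s ω) atTop (𝓝 L) := by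
  set M : ℕ → Ω → ℝ := fun n ω => ∑ s ∈ Finset.range n, Y s ω with hM
  have hYm : ∀ n, AEStronglyMeasurable (Y n) μ := fun n =>
    ((hY n).mono (ℱ.le _)).aestronglyMeasurable
  have hYint : ∀ n, Integrable (Y n) μ := fun n =>
    Integrable.of_bound (hYm n) (c n) (by simpa only [Real.norm_eq_abs] using hbound n)
  have hMint : ∀ n, Integrable (M n) μ := fun n => integrable_finsetSum _ fun s _ => hYint s
  have hMadp : StronglyAdapted ℱ M := fun n =>
    Finset.stronglyMeasurable_fun_sum _ fun s hs =>
      (hY s).mono (ℱ.mono (Finset.mem_range.1 hs))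
  have hMbound : ∀ n, ∀ᵐ ω ∂μ, ‖M n ω‖ ≤ ∑ s ∈ Finset.range n, c s := fun n => by
    filter_upwards [ae_all_iff.2 hbound] with ω hω
    exact (Finset.abs_sum_le_sum_abs _ _).trans (Finset.sum_le_sum fun s _ => hω s)
  have hsucc : ∀ n, M (n + 1) = fun ω => M n ω + Y n ω := fun n => by
    ext ω; simp only [hM, Finset.sum_range_succ]
  have hmart : Martingale M ℱ μ := by
    refine martingale_of_condExp_sub_eq_zero_nat hMadp hMint fun n => ?_
    have : M (n + 1) - M n = Y n := by ext ω; simp [hsucc]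
    rw [this]
    exact hcond n
  have hMMem : ∀ n, MemLp (M n) 2 μ := fun n =>
    MemLp.of_bound (hMint n).aestronglyMeasurable _ (hMbound n)
  have hYMem : ∀ n, MemLp (Y n) 2 μ := fun n =>
    MemLp.of_bound (hYm n) (c n) (by simpa only [Real.norm_eq_abs] using hbound n)
  -- `M n` is known at time `n`, so it factors out of the conditional expectation; second moments
  -- then add up.
  have horth : ∀ n, ∫ ω, M n ω * Y n ω ∂μ = 0 := fun n => by
    have hMY : Integrable (M n * Y n) μ := (hMMem n).integrable_mul (hYMem n)
    have h1 : μ[M n * Y n | ℱ n] =ᵐ[μ] 0 := by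
      filter_upwards [condExp_mul_of_stronglyMeasurable_left (hMadp n) hMY (hYint n), hcond n]
        with ω h1 h2
      rw [h1, Pi.mul_apply, h2, Pi.zero_apply, mul_zero]
    have h2 : ∫ ω, (M n * Y n) ω ∂μ = 0 := by
      rw [← integral_condExp (ℱ.le n), integral_congr_ae h1]
      simp
    exact h2
  have hsq : ∀ n, ∫ ω, M n ω ^ 2 ∂μ ≤ ∑ s ∈ Finset.range n, c s ^ 2 := fun n => by
    induction n with
    | zero => simp [hM]
    | succ n ih =>
      have hYsq : ∫ ω, Y n ω ^ 2 ∂μ ≤ c n ^ 2 := by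
        calc ∫ ω, Y n ω ^ 2 ∂μ ≤ ∫ _, c n ^ 2 ∂μ := by
              refine integral_mono_ae (hYMem n).integrable_sq (integrable_const _) ?_
              filter_upwards [hbound n] with ω hω
              exact sq_le_sq' (abs_le.1 hω).1 (abs_le.1 hω).2
          _ = c n ^ 2 := by simp
      have hMY : Integrable (fun ω => M n ω * Y n ω) μ := (hMMem n).integrable_mul (hYMem n)
      have hexp : ∫ ω, M (n + 1) ω ^ 2 ∂μ
          = ∫ ω, M n ω ^ 2 ∂μ + 2 * ∫ ω, M n ω * Y n ω ∂μ + ∫ ω, Y n ω ^ 2 ∂μ := by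
        have hMsq := (hMMem n).integrable_sq
        rw [← integral_const_mul, ← integral_add hMsq (hMY.const_mul 2),
          ← integral_add (f := fun ω => M n ω ^ 2 + 2 * (M n ω * Y n ω))
            (hMsq.add (hMY.const_mul 2)) (hYMem n).integrable_sq]
        congr 1
        ext ω
        simp only [hsucc]
        ring
      rw [hexp, horth, Finset.sum_range_succ]
      linarith
  set R : ℝ := 1 + ∑' n, c n ^ 2
  have hL1 : ∀ n, eLpNorm (M n) 1 μ ≤ (R.toNNReal : ENNReal) := fun n => by
    rw [eLpNorm_one_eq_lintegral_enorm, ← ofReal_integral_norm_eq_lintegral_enorm (hMint n)]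
    refine ENNReal.ofReal_le_ofReal ?_
    calc ∫ ω, ‖M n ω‖ ∂μ ≤ ∫ ω, (1 + M n ω ^ 2) ∂μ := by
          refine integral_mono (hMint n).norm
            ((integrable_const _).add (hMMem n).integrable_sq) fun ω => ?_
          simp only [Real.norm_eq_abs]
          nlinarith [sq_nonneg (|M n ω| - 1), sq_abs (M n ω), abs_nonneg (M n ω)]
      _ = 1 + ∫ ω, M n ω ^ 2 ∂μ := by
          rw [integral_add (integrable_const _) (hMMem n).integrable_sq]; simp
      _ ≤ R := by
          have := hc.sum_le_tsum (Finset.range n) (fun _ _ => sq_nonneg _)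
          have := hsq n
          simp only [R]; linarith
  filter_upwards [hmart.submartingale.ae_tendsto_limitProcess hL1] with ω hω
  exact ⟨_, hω⟩

end Probability

/-! ### Taylor estimate and real sequences. -/

section Analysis

variable {E : Type*} [NormedAddCommGroup E] [InnerProductSpace ℝ E]

/-- First-order Taylor estimate for a function with a Hölder continuous gradient. -/
theorem abs_sub_sub_inner_gradient_le [CompleteSpace E] {f : E → ℝ} (hf : Differentiable ℝ f)
    {A α : ℝ} (hA : 0 ≤ A) (hα : 0 < α)
    (hol : ∀ x y, ‖gradient f x - gradient f y‖ ≤ A * ‖x - y‖ ^ α) (x y : E) :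
    |f y - f x - inner ℝ (gradient f x) (y - x)| ≤ A * ‖y - x‖ ^ (1 + α) := by
  have key := (convex_segment x y).norm_image_sub_le_of_norm_hasFDerivWithin_le'
    (f := f) (f' := fun z => InnerProductSpace.toDual ℝ E (gradient f z))
    (φ := InnerProductSpace.toDual ℝ E (gradient f x)) (C := A * ‖y - x‖ ^ α)
    (fun z _ => (hf z).hasGradientAt.hasFDerivAt.hasFDerivWithinAt)
    (fun z hz => ?_) (left_mem_segment ℝ x y) (right_mem_segment ℝ x y)
  · rw [InnerProductSpace.toDual_apply_apply, Real.norm_eq_abs] at key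
    refine key.trans_eq ?_
    rw [add_comm 1 α, mul_assoc, Real.rpow_add_one' (norm_nonneg _) (by linarith)]
  · rw [← map_sub, LinearIsometryEquiv.norm_map]
    refine (hol z x).trans ?_
    gcongr
    rw [← dist_eq_norm, ← dist_eq_norm, dist_comm z x, dist_comm y x]
    have := dist_add_dist_of_mem_segment hz
    have := dist_nonneg (x := z) (y := y)
    linarith

/-- A geometric average of terms of order `(t + 1) ^ (-q)` is of order `(t + 1) ^ (-q)`. -/
theorem exists_le_rpow_of_geometric_recursion {q β K : ℝ} (hq0 : 0 < q) (hq1 : q ≤ 1)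
    (hβ₀ : 0 ≤ β) (hβ₁ : β < 1) (hK : 0 ≤ K) :
    ∃ C : ℝ, 0 < C ∧ ∀ a : ℕ → ℝ, a 0 = 0 →
      (∀ t : ℕ, a (t + 1) ≤ β * a t + K * ((t : ℝ) + 1) ^ (-q)) →
      ∀ t : ℕ, a t ≤ C * ((t : ℝ) + 1) ^ (-q) := by
  -- The shift solves `T / (T + 1) = (1 + β) / 2`, so consecutive shifted weights have ratio at
  -- least `(1 + β) / 2 > β` from `t = 0` on. The slack `(1 - β) / 2 * C` absorbs the forcing term.
  set T : ℝ := (1 + β) / (1 - β) with hT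
  have h1β : 0 < 1 - β := by linarith
  have hT1 : 1 ≤ T := by rw [hT, le_div_iff₀ h1β]; linarith
  set C : ℝ := 2 * (K * T ^ q) / (1 - β) + 1 with hC
  have hTq : 0 < T ^ q := Real.rpow_pos_of_pos (by linarith) _
  have hC0 : 0 < C := by positivity
  refine ⟨C, hC0, fun a h0 ha t => ?_⟩
  have main : ∀ t : ℕ, a t ≤ C * ((t : ℝ) + T) ^ (-q) := fun t => by
    induction t with
    | zero => rw [h0]; positivity
    | succ t ih =>
      have ht : (0 : ℝ) ≤ t := t.cast_nonneg
      have hpos : 0 < (t : ℝ) + T := by linarith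
      have hw : ((t : ℝ) + 1) ^ (-q) ≤ T ^ q * ((t : ℝ) + T) ^ (-q) := by
        have h1 : ((t : ℝ) + T) ≤ T * (t + 1) := by nlinarith
        have h2 : ((t : ℝ) + T) ^ q ≤ T ^ q * (t + 1) ^ q := by
          rw [← Real.mul_rpow (by linarith) (by linarith)]
          exact Real.rpow_le_rpow hpos.le h1 hq0.le
        rw [Real.rpow_neg (by linarith), Real.rpow_neg hpos.le, inv_eq_one_div,
          ← div_eq_mul_inv, div_le_div_iff₀ (by positivity) (by positivity)]
        linarith
      have hr : (1 + β) / 2 * ((t : ℝ) + T) ^ (-q) ≤ ((t + 1 : ℕ) + T) ^ (-q) := by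
        set u : ℝ := (t : ℝ) + T with hu
        have hcast : (((t + 1 : ℕ) : ℝ) + T) = u + 1 := by push_cast; ring
        rw [hcast]
        have h1 : (1 + β) / 2 ≤ u / (u + 1) := by
          rw [div_le_div_iff₀ (by norm_num) (by linarith)]
          have h2 : T * (1 - β) = 1 + β := by rw [hT]; field_simp
          nlinarith
        have h2 : u / (u + 1) ≤ (u / (u + 1)) ^ q := by
          have h01 : u / (u + 1) ≤ 1 := by rw [div_le_one (by linarith)]; linarith
          simpa using Real.rpow_le_rpow_of_exponent_ge (by positivity) h01 hq1
        have h3 : (u / (u + 1)) ^ q * u ^ (-q) = (u + 1) ^ (-q) := by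
          rw [Real.div_rpow hpos.le (by linarith), Real.rpow_neg hpos.le,
            Real.rpow_neg (by linarith)]
          have : u ^ q ≠ 0 := (Real.rpow_pos_of_pos hpos _).ne'
          field_simp
        rw [← h3]
        gcongr
        exact h1.trans h2
      have hCeq : β * C + K * T ^ q ≤ C * ((1 + β) / 2) := by
        have : (C - 1) * (1 - β) = 2 * (K * T ^ q) := by rw [hC]; field_simp; ring
        nlinarith
      calc a (t + 1) ≤ β * a t + K * ((t : ℝ) + 1) ^ (-q) := ha t
        _ ≤ β * (C * ((t : ℝ) + T) ^ (-q)) + K * (T ^ q * ((t : ℝ) + T) ^ (-q)) := by gcongr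
        _ = (β * C + K * T ^ q) * ((t : ℝ) + T) ^ (-q) := by ring
        _ ≤ C * ((1 + β) / 2) * ((t : ℝ) + T) ^ (-q) := by gcongr
        _ = C * ((1 + β) / 2 * ((t : ℝ) + T) ^ (-q)) := by ring
        _ ≤ _ := by gcongr
  refine (main t).trans ?_
  have ht : (0 : ℝ) ≤ t := t.cast_nonneg
  gcongr C * ?_
  exact Real.rpow_le_rpow_of_nonpos (by linarith) (by linarith) (by linarith)

/-- Deterministic Robbins–Siegmund lemma. -/
theorem exists_tendsto_and_summable_of_descent {a b c : ℕ → ℝ} {l S : ℝ} (ha : ∀ n, l ≤ a n)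
    (hb : ∀ n, 0 ≤ b n) (hc : Tendsto (fun n => ∑ s ∈ Finset.range n, c s) atTop (𝓝 S))
    (h : ∀ n, a (n + 1) ≤ a n - b n + c n) :
    (∃ L, Tendsto a atTop (𝓝 L)) ∧ Summable b := by
  set C : ℕ → ℝ := fun n => ∑ s ∈ Finset.range n, c s with hC
  have hCs : ∀ n, C (n + 1) = C n + c n := fun n => Finset.sum_range_succ _ _
  obtain ⟨B, hB⟩ := hc.bddAbove_range
  have hBn : ∀ n, C n ≤ B := fun n => hB ⟨n, rfl⟩
  constructor
  -- Removing the accumulated `c` leaves a monotone sequence; only convergence of the partial sums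
  -- matters, not the sign of `c`.
  · have hanti : Antitone fun n => a n - C n := antitone_nat_of_succ_le fun n => by
      have := h n; have := hb n; have := hCs n; linarith
    have hbdd : BddBelow (Set.range fun n => a n - C n) := by
      refine ⟨l - B, ?_⟩
      rintro _ ⟨n, rfl⟩
      have := ha n; have := hBn n
      simp only; linarith
    refine ⟨_, ((tendsto_atTop_ciInf hanti hbdd).add hc).congr fun n => ?_⟩
    ring
  · refine summable_of_sum_range_le (c := a 0 - l + B) hb fun n => ?_
    have : ∀ n, ∑ i ∈ Finset.range n, b i ≤ a 0 - a n + C n := fun n => by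
      induction n with
      | zero => simp [hC]
      | succ n ih => rw [Finset.sum_range_succ]; have := h n; have := hCs n; linarith
    have := this n; have := ha n; have := hBn n
    linarith

/-- A nonnegative sequence that is square-summable against a divergent weight and whose variation
is Hölder-controlled by the weight tends to zero. -/
theorem tendsto_zero_of_summable_mul_sq {a w : ℕ → ℝ} {C α : ℝ} (hw : ∀ n, 0 ≤ w n)
    (hwdiv : ¬ Summable w) (ha : ∀ n, 0 ≤ a n) (hsum : Summable fun n => w n * a n ^ 2)
    (hC : 0 ≤ C) (hα : 0 < α)
    (hvar : ∀ m n, m ≤ n → |a n - a m| ≤ C * (∑ s ∈ Finset.Ico m n, w s) ^ α) :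
    Tendsto a atTop (𝓝 0) := by
  rw [Metric.tendsto_atTop]
  intro ε hε
  -- Over a stretch of weight less than `τ`, `a` moves by less than `ε / 2`.
  obtain ⟨τ, hτ, hτC⟩ : ∃ τ : ℝ, 0 < τ ∧ C * τ ^ α < ε / 2 := by
    have h1 : Tendsto (fun τ : ℝ => C * τ ^ α) (𝓝[>] 0) (𝓝 (C * 0 ^ α)) :=
      ((Real.continuousAt_rpow_const 0 α (Or.inr hα.le)).tendsto.mono_left
        nhdsWithin_le_nhds).const_mul C
    rw [Real.zero_rpow hα.ne', mul_zero] at h1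
    obtain ⟨τ, h2, h3⟩ := ((h1.eventually_lt_const (half_pos hε)).and
      self_mem_nhdsWithin).exists
    exact ⟨τ, h3, h2⟩
  have htail : ∃ N, ∀ m n, N ≤ m → m ≤ n →
      ∑ s ∈ Finset.Ico m n, w s * a s ^ 2 < (ε / 2) ^ 2 * τ := by
    have hcau := hsum.hasSum.tendsto_sum_nat.cauchySeq
    obtain ⟨N, hN⟩ := Metric.cauchySeq_iff.1 hcau ((ε / 2) ^ 2 * τ) (by positivity)
    refine ⟨N, fun m n hm hmn => ?_⟩
    rw [Finset.sum_Ico_eq_sub _ hmn]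
    exact (le_abs_self _).trans_lt (hN n (hm.trans hmn) m hm)
  obtain ⟨N, hN⟩ := htail
  refine ⟨N, fun m hm => ?_⟩
  rw [Real.dist_eq, sub_zero, abs_of_nonneg (ha m)]
  by_contra! hcon
  -- From `a m ≥ ε` the sequence must fall to `ε / 2`, else `w` would be summable. Before the first
  -- such time `a` stays above `ε / 2`, so the small tail forces weight below `τ`, too little for
  -- the fall.
  have hex : ∃ k, a (m + k) ≤ ε / 2 := by
    by_contra! hk
    refine hwdiv ((summable_nat_add_iff m).1 ?_)
    refine Summable.of_nonneg_of_le (fun n => hw _) (fun n => ?_)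
      (((summable_nat_add_iff m).2 hsum).mul_left ((ε / 2) ^ 2)⁻¹)
    rw [inv_mul_eq_div, le_div_iff₀ (by positivity)]
    have h1 := hk n
    rw [add_comm m n] at h1
    gcongr
    exact hw _
  classical
  set k := Nat.find hex with hk
  have hkle : a (m + k) ≤ ε / 2 := Nat.find_spec hex
  have hbefore : ∀ s ∈ Finset.Ico m (m + k), ε / 2 ≤ a s := fun s hs => by
    rw [Finset.mem_Ico] at hs
    have h1 : s - m < k := by omega
    have h2 := Nat.find_min hex h1
    rw [show m + (s - m) = s by omega] at h2
    linarith
  have hsumw : ∑ s ∈ Finset.Ico m (m + k), w s < τ := by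
    have h1 := hN m (m + k) hm (by omega)
    have h2 : (ε / 2) ^ 2 * ∑ s ∈ Finset.Ico m (m + k), w s
        ≤ ∑ s ∈ Finset.Ico m (m + k), w s * a s ^ 2 := by
      rw [Finset.mul_sum]
      refine Finset.sum_le_sum fun s hs => ?_
      rw [mul_comm]
      have := hbefore s hs
      gcongr
      exact hw _
    exact lt_of_mul_lt_mul_left (h2.trans_lt h1) (by positivity)
  have h3 := hvar m (m + k) (by omega)
  have h4 : C * (∑ s ∈ Finset.Ico m (m + k), w s) ^ α ≤ C * τ ^ α := by
    have : 0 ≤ ∑ s ∈ Finset.Ico m (m + k), w s := Finset.sum_nonneg fun s _ => hw s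
    gcongr
  have := (abs_le.1 h3).1
  linarith

theorem summable_rpow_neg_add_one {r : ℝ} :
    (Summable fun t : ℕ => ((t : ℝ) + 1) ^ (-r)) ↔ 1 < r := by
  have := summable_nat_add_iff (f := fun t : ℕ => (t : ℝ) ^ (-r)) 1
  push_cast at this
  rw [this, Real.summable_nat_rpow]
  constructor <;> intro h <;> linarith

theorem rpow_neg_rpow {q r : ℝ} (t : ℕ) :
    (((t : ℝ) + 1) ^ (-q)) ^ r = ((t : ℝ) + 1) ^ (-(q * r)) := by
  rw [← Real.rpow_mul (by positivity)]; ring_nf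

/-- If `a` is summable against `(t + 1) ^ (-q)`, then `t ^ (1 - q) * a t` has lower limit zero. -/
theorem liminf_rpow_mul_eq_zero {a : ℕ → ℝ} {q : ℝ} (ha : ∀ t, 0 ≤ a t) (hq : q ≤ 1)
    (hsum : Summable fun t : ℕ => ((t : ℝ) + 1) ^ (-q) * a t) :
    liminf (fun t : ℕ => (((t : ℝ) ^ (1 - q) * a t : ℝ) : EReal)) atTop = 0 := by
  refine le_antisymm ?_ ?_
  · by_contra! hlt
    obtain ⟨c, hc0, hc⟩ := EReal.lt_iff_exists_real_btwn.1 hlt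
    have hc0' : 0 < c := by exact_mod_cast hc0
    have hev := eventually_lt_of_lt_liminf hc
    obtain ⟨N, hN⟩ := eventually_atTop.1 hev
    -- Eventually `(t + 1) ^ (-q) * a t ≥ c / (t + 1)`. The shifts `N + 1` and `N` pair `1 / (t +
    -- 1)` with the term at `t`.
    refine Real.not_summable_one_div_natCast ((summable_nat_add_iff (N + 1)).1 ?_)
    have h1 : Summable fun t : ℕ => ((t : ℝ) + 1) ^ (-q) * a t * (1 / c) := hsum.mul_right _
    refine Summable.of_nonneg_of_le (fun n => by positivity) (fun n => ?_)
      ((summable_nat_add_iff N).2 h1)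
    have h2 : c < ((n + N : ℕ) : ℝ) ^ (1 - q) * a (n + N) := by
      exact_mod_cast hN (n + N) (by omega)
    set u : ℝ := ((n + N : ℕ) : ℝ) with hu
    have hu0 : 0 ≤ u := Nat.cast_nonneg _
    have hcast : ((n + (N + 1) : ℕ) : ℝ) = u + 1 := by rw [hu]; push_cast; ring
    rw [hcast]
    have h3 : u ^ (1 - q) ≤ (u + 1) ^ (1 - q) :=
      Real.rpow_le_rpow hu0 (by linarith) (by linarith)
    have h4 : c ≤ (u + 1) ^ (1 - q) * a (n + N) :=
      h2.le.trans (mul_le_mul_of_nonneg_right h3 (ha _))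
    have h5 : (u + 1) ^ (1 - q) = (u + 1) * (u + 1) ^ (-q) := by
      rw [sub_eq_add_neg, Real.rpow_add (by linarith), Real.rpow_one]
    rw [h5] at h4
    rw [mul_one_div, div_le_div_iff₀ (by linarith) hc0']
    linarith
  · refine le_liminf_of_le (by isBoundedDefault) (Eventually.of_forall fun t => ?_)
    have := ha t
    exact_mod_cast (by positivity : (0 : ℝ) ≤ (t : ℝ) ^ (1 - q) * a t)

end Analysis

/-! ### Deterministic convergence along one path. -/

section Path

variable {E : Type*} [NormedAddCommGroup E] [InnerProductSpace ℝ E] [CompleteSpace E]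

/-- Convergence of stochastic gradient descent with momentum along a single path on which the
weighted sum of the noise converges. -/
theorem converges_of_tendsto_sum_noise {f : E → ℝ} (hf : Differentiable ℝ f)
    (hf_inf : BddBelow (Set.range f)) {A α : ℝ} (hA : 0 < A) (hα : 0 < α)
    (hol : ∀ x y, ‖gradient f x - gradient f y‖ ≤ A * ‖x - y‖ ^ α)
    {β q c₀ c₁ G S : ℝ} (hβ₀ : 0 ≤ β) (hβ₁ : β < 1) (hq0 : 0 < q) (hq1 : q ≤ 1)
    (hqα : 1 < q * (1 + α)) (hc₀ : 0 < c₀) (hc₁ : 0 < c₁) (hG : 0 < G)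
    {x m g : ℕ → E} {γ : ℕ → ℝ} (hm0 : m 0 = 0)
    (hm : ∀ t, m (t + 1) = β • m t - γ t • g t) (hx : ∀ t, x (t + 1) = x t + m (t + 1))
    (hγ₀ : ∀ t : ℕ, c₀ * ((t : ℝ) + 1) ^ (-q) ≤ γ t)
    (hγ₁ : ∀ t : ℕ, γ t ≤ c₁ * ((t : ℝ) + 1) ^ (-q))
    (hgrad : ∀ t, ‖gradient f (x t)‖ ≤ G) (hg : ∀ t, ‖g t‖ ≤ G)
    (hnoise : Tendsto (fun n => ∑ t ∈ Finset.range n,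
      γ t * inner ℝ (gradient f (x t)) (g t - gradient f (x t))) atTop (𝓝 S)) :
    Tendsto (fun t => gradient f (x t)) atTop (𝓝 0) ∧
    (∃ L : ℝ, Tendsto (fun t => f (x t)) atTop (𝓝 L)) ∧
    liminf (fun t : ℕ => (((t : ℝ) ^ (1 - q) * ‖gradient f (x t)‖ ^ 2 : ℝ) : EReal)) atTop = 0 := by
  have h1β : 0 < 1 - β := by linarith
  set w : ℕ → ℝ := fun t => ((t : ℝ) + 1) ^ (-q) with hw
  have hw0 : ∀ t, 0 < w t := fun t => by simp only [hw]; positivity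
  have hγpos : ∀ t, 0 < γ t := fun t => (mul_pos hc₀ (hw0 t)).trans_le (hγ₀ t)
  have hwsum : Summable fun t => w t ^ (1 + α) := by
    simp only [hw, rpow_neg_rpow]
    exact summable_rpow_neg_add_one.2 hqα
  have hwlim : Tendsto w atTop (𝓝 0) := by
    have h1 := (tendsto_rpow_neg_atTop hq0).comp
      (tendsto_natCast_atTop_atTop (R := ℝ) |>.atTop_add (tendsto_const_nhds (x := (1 : ℝ))))
    exact h1
  have hwdiv : ¬ Summable w := fun h => by
    have := summable_rpow_neg_add_one.1 h
    linarith
  have hwanti : ∀ t, w (t + 1) ≤ w t := fun t => by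
    simp only [hw]
    exact Real.rpow_le_rpow_of_nonpos (by positivity) (by push_cast; linarith) (by linarith)
  -- the momentum has the order of the stepsizes
  obtain ⟨C, hC0, hC⟩ := exists_le_rpow_of_geometric_recursion hq0 hq1 hβ₀ hβ₁
    (mul_pos hc₁ hG).le
  have hmw : ∀ t, ‖m t‖ ≤ C * w t := hC (fun t => ‖m t‖) (by simp [hm0]) fun t => by
    rw [hm]
    refine (norm_sub_le _ _).trans ?_
    rw [norm_smul, norm_smul, Real.norm_eq_abs, Real.norm_eq_abs, abs_of_nonneg hβ₀,
      abs_of_pos (hγpos t)]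
    have : γ t * ‖g t‖ ≤ (c₁ * w t) * G :=
      mul_le_mul (hγ₁ t) (hg t) (norm_nonneg _) (mul_pos hc₁ (hw0 t)).le
    have : (c₁ * w t) * G = c₁ * G * ((t : ℝ) + 1) ^ (-q) := by simp only [hw]; ring
    linarith
  -- the auxiliary sequence absorbing the momentum
  set b : ℝ := β / (1 - β) with hb
  have hb0 : 0 ≤ b := div_nonneg hβ₀ h1β.le
  set z : ℕ → E := fun t => x t + b • m t with hz
  set η : ℕ → ℝ := fun t => γ t / (1 - β) with hη
  have hη0 : ∀ t, 0 < η t := fun t => div_pos (hγpos t) h1β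
  have hηw : ∀ t, η t ≤ c₁ / (1 - β) * w t := fun t => by
    simp only [hη]
    rw [div_mul_eq_mul_div]
    exact div_le_div_of_nonneg_right (hγ₁ t) h1β.le
  set e : ℝ := c₁ / (1 - β) with he
  have he0 : 0 < e := div_pos hc₁ h1β
  -- The identity `b = (1 + b) * β` makes the momentum terms cancel.
  have hzstep : ∀ t, z (t + 1) - z t = -(η t • g t) := fun t => by
    have h1 : 1 + b = 1 / (1 - β) := by rw [hb]; field_simp; ring
    have h2 : b = (1 + b) * β := by rw [h1, hb]; ring
    have h3 : η t = (1 + b) * γ t := by rw [h1]; simp only [hη]; ring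
    simp only [hz]
    rw [h3, hx]
    have h4 : x t + m (t + 1) + b • m (t + 1) - (x t + b • m t)
        = (1 + b) • m (t + 1) - b • m t := by module
    rw [h4, hm]
    nth_rw 2 [h2]
    module
  have hzx : ∀ t, ‖z t - x t‖ ≤ b * C * w t := fun t => by
    simp only [hz]
    rw [add_sub_cancel_left, norm_smul, Real.norm_eq_abs, abs_of_nonneg hb0, mul_assoc]
    gcongr
    exact hmw t
  -- The first term is the Taylor remainder for a step of length `e * G * w t`; the second is the
  -- cost of replacing the gradient at `z t` by that at `x t`, a distance `b * C * w t` away.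
  set D : ℝ := A * (e * G) ^ (1 + α) + e * G * A * (b * C) ^ α with hD
  have hdescent : ∀ t, f (z (t + 1)) ≤ f (z t) - η t * ‖gradient f (x t)‖ ^ 2
      + (-(1 / (1 - β)) * (γ t * inner ℝ (gradient f (x t)) (g t - gradient f (x t)))
        + D * w t ^ (1 + α)) := fun t => by
    have htay := (abs_le.1 (abs_sub_sub_inner_gradient_le hf hA.le hα hol (z t) (z (t + 1)))).2
    have hstep : ‖z (t + 1) - z t‖ ≤ e * G * w t := by
      rw [hzstep, norm_neg, norm_smul, Real.norm_eq_abs, abs_of_pos (hη0 t)]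
      calc η t * ‖g t‖ ≤ (e * w t) * G :=
            mul_le_mul (hηw t) (hg t) (norm_nonneg _) (mul_pos he0 (hw0 t)).le
        _ = _ := by ring
    have h1 : A * ‖z (t + 1) - z t‖ ^ (1 + α) ≤ A * (e * G) ^ (1 + α) * w t ^ (1 + α) := by
      rw [mul_assoc, ← Real.mul_rpow (by positivity) (hw0 t).le]
      gcongr
    have h2 : inner ℝ (gradient f (z t)) (z (t + 1) - z t)
        = -(η t * inner ℝ (gradient f (x t)) (g t))
          - η t * inner ℝ (gradient f (z t) - gradient f (x t)) (g t) := by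
      rw [hzstep, inner_neg_right, real_inner_smul_right, inner_sub_left]
      ring
    have h3 : -(η t * inner ℝ (gradient f (z t) - gradient f (x t)) (g t))
        ≤ e * G * A * (b * C) ^ α * w t ^ (1 + α) := by
      have h4 : ‖gradient f (z t) - gradient f (x t)‖ ≤ A * (b * C * w t) ^ α := by
        refine (hol _ _).trans ?_
        have := hzx t
        gcongr
      have h5 : |inner ℝ (gradient f (z t) - gradient f (x t)) (g t)|
          ≤ A * (b * C * w t) ^ α * G :=
        (abs_real_inner_le_norm _ _).trans
          (mul_le_mul h4 (hg t) (norm_nonneg _) ((norm_nonneg _).trans h4))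
      have h6 := (abs_le.1 h5).1
      calc -(η t * inner ℝ (gradient f (z t) - gradient f (x t)) (g t))
          = η t * -inner ℝ (gradient f (z t) - gradient f (x t)) (g t) := by ring
        _ ≤ η t * (A * (b * C * w t) ^ α * G) := by
            have := (hη0 t).le
            gcongr
            linarith
        _ ≤ (e * w t) * (A * (b * C * w t) ^ α * G) := by
            have := (hw0 t).le
            gcongr
            exact hηw t
        _ = _ := by
            rw [Real.mul_rpow (by positivity) (hw0 t).le, Real.rpow_add (hw0 t), Real.rpow_one]
            ring
    have h7 : inner ℝ (gradient f (x t)) (g t - gradient f (x t))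
        = inner ℝ (gradient f (x t)) (g t) - ‖gradient f (x t)‖ ^ 2 := by
      rw [inner_sub_right, real_inner_self_eq_norm_sq]
    have h8 : η t = 1 / (1 - β) * γ t := by simp only [hη]; ring
    have h9 : -(1 / (1 - β)) * (γ t * inner ℝ (gradient f (x t)) (g t - gradient f (x t)))
        = -(η t * inner ℝ (gradient f (x t)) (g t)) + η t * ‖gradient f (x t)‖ ^ 2 := by
      rw [h7, h8]; ring
    rw [h9, hD, add_mul]
    rw [h2] at htay
    linarith
  obtain ⟨l, hl⟩ := hf_inf
  have hnoise' : Tendsto (fun n => ∑ t ∈ Finset.range n,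
      (-(1 / (1 - β)) * (γ t * inner ℝ (gradient f (x t)) (g t - gradient f (x t)))
        + D * w t ^ (1 + α))) atTop (𝓝 (-(1 / (1 - β)) * S + D * ∑' t, w t ^ (1 + α))) := by
    simp only [Finset.sum_add_distrib, ← Finset.mul_sum]
    exact (hnoise.const_mul _).add (hwsum.hasSum.tendsto_sum_nat.const_mul _)
  obtain ⟨⟨L, hL⟩, hsum⟩ := exists_tendsto_and_summable_of_descent (a := fun t => f (z t))
    (fun t => hl ⟨z t, rfl⟩) (fun t => mul_nonneg (hη0 t).le (sq_nonneg _)) hnoise' hdescent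
  have hwgrad : Summable fun t => w t * ‖gradient f (x t)‖ ^ 2 := by
    refine Summable.of_nonneg_of_le (fun t => mul_nonneg (hw0 t).le (sq_nonneg _)) (fun t => ?_)
      (hsum.mul_left ((1 - β) / c₀))
    rw [← mul_assoc]
    gcongr
    simp only [hη]
    rw [div_mul_div_comm, le_div_iff₀ (by positivity)]
    nlinarith [hγ₀ t]
  have hxstep : ∀ t, ‖x (t + 1) - x t‖ ≤ C * w t := fun t => by
    rw [hx, add_sub_cancel_left]
    exact (hmw _).trans (mul_le_mul_of_nonneg_left (hwanti t) hC0.le)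
  have hxvar : ∀ k n, k ≤ n → ‖x n - x k‖ ≤ C * ∑ s ∈ Finset.Ico k n, w s := fun k n hkn => by
    rw [← Finset.sum_Ico_sub _ hkn, Finset.mul_sum]
    exact norm_sum_le_of_le _ fun s _ => hxstep s
  refine ⟨?_, ⟨L, ?_⟩, ?_⟩
  · rw [tendsto_zero_iff_norm_tendsto_zero]
    refine tendsto_zero_of_summable_mul_sq (C := A * C ^ α) (fun t => (hw0 t).le) hwdiv
      (fun _ => norm_nonneg _) hwgrad (by positivity) hα fun k n hkn => ?_
    refine (abs_norm_sub_norm_le _ _).trans ((hol _ _).trans ?_)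
    rw [mul_assoc, ← Real.mul_rpow hC0.le (Finset.sum_nonneg fun s _ => (hw0 s).le)]
    have := hxvar k n hkn
    gcongr
  -- The limit of `f (z t)` passes to `f (x t)` because `z t - x t` vanishes and the gradients at `x
  -- t` are bounded.
  · have hdiff : Tendsto (fun t => f (z t) - f (x t)) atTop (𝓝 0) := by
      refine squeeze_zero_norm (a := fun t =>
        A * (b * C * w t) ^ (1 + α) + G * (b * C * w t)) (fun t => ?_) ?_
      · have h1 := abs_sub_sub_inner_gradient_le hf hA.le hα hol (x t) (z t)
        have h2 : |inner ℝ (gradient f (x t)) (z t - x t)| ≤ G * (b * C * w t) :=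
          (abs_real_inner_le_norm _ _).trans
            (mul_le_mul (hgrad t) (hzx t) (norm_nonneg _) hG.le)
        have h3 : A * ‖z t - x t‖ ^ (1 + α) ≤ A * (b * C * w t) ^ (1 + α) := by
          have := hzx t
          gcongr
        rw [Real.norm_eq_abs]
        have h4 := abs_add_le (f (z t) - f (x t) - inner ℝ (gradient f (x t)) (z t - x t))
          (inner ℝ (gradient f (x t)) (z t - x t))
        rw [sub_add_cancel] at h4
        linarith
      · have h1 : Tendsto (fun t => b * C * w t) atTop (𝓝 0) := by
          simpa using hwlim.const_mul (b * C)
        have h2 := h1.rpow_const (p := 1 + α) (Or.inr (by linarith))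
        rw [Real.zero_rpow (by linarith)] at h2
        simpa using (h2.const_mul A).add (h1.const_mul G)
    simpa using hL.sub hdiff
  · exact liminf_rpow_mul_eq_zero (fun _ => sq_nonneg _) hq1 hwgrad

end Path

/-! ### Measurability, stepsize bounds and noise of the algorithm. -/

/-- The σ-algebra at time `n` is generated by the noise variables `ξ i`, `i < n`. -/
def noiseFiltration {Ω S : Type*} {mΩ : MeasurableSpace Ω} [mS : MeasurableSpace S] (ξ : ℕ → Ω → S)
    (hξ : ∀ t, Measurable (ξ t)) : Filtration ℕ mΩ where
  seq n := ⨆ i ∈ Set.Iio n, mS.comap (ξ i)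
  mono' _ _ hkn := biSup_mono fun _ hi => lt_of_lt_of_le hi hkn
  le' _ := iSup₂_le fun i _ => (hξ i).comap_le

theorem measurable_noiseFiltration {Ω S : Type*} {mΩ : MeasurableSpace Ω} [mS : MeasurableSpace S]
    {ξ : ℕ → Ω → S} (hξ : ∀ t, Measurable (ξ t)) {i n : ℕ} (h : i < n) :
    Measurable[noiseFiltration ξ hξ n] (ξ i) := by
  rw [measurable_iff_comap_le]
  exact le_iSup₂_of_le (f := fun i (_ : i ∈ Set.Iio n) => mS.comap (ξ i)) i h le_rfl

theorem indep_noiseFiltration {Ω S : Type*} {mΩ : MeasurableSpace Ω} [mS : MeasurableSpace S]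
    {μ : Measure Ω} {ξ : ℕ → Ω → S} (hξ : ∀ t, Measurable (ξ t)) (hind : iIndepFun ξ μ) (n : ℕ) :
    Indep (noiseFiltration ξ hξ n) (mS.comap (ξ n)) μ := by
  have h := indep_iSup_of_disjoint (fun i => (hξ i).comap_le) hind.iIndep
    (S := Set.Iio n) (T := {n}) (by simp)
  rw [iSup_singleton] at h
  exact h

variable {d : ℕ} {S : Type*}

theorem measurable_stepsize (p : Params) (t : ℕ) : Measurable (stepsize p t) := by
  unfold stepsize
  fun_prop

/-- The state at time `t` is a measurable function of the noise before time `t`. -/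
theorem measurable_run {Ω : Type*} {_ : MeasurableSpace Ω} [MeasurableSpace S] (p : Params)
    {g : EuclideanSpace ℝ (Fin d) → S → EuclideanSpace ℝ (Fin d)}
    (hg : Measurable (Function.uncurry g)) (x₀ : EuclideanSpace ℝ (Fin d)) {ξ : ℕ → Ω → S} (t : ℕ)
    (hξ : ∀ i < t, Measurable (ξ i)) :
    (Measurable fun ω => (run p g x₀ (fun i => ξ i ω) t).v) ∧
    (Measurable fun ω => (run p g x₀ (fun i => ξ i ω) t).m) ∧
    (Measurable fun ω => (run p g x₀ (fun i => ξ i ω) t).x) := by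
  induction t with
  | zero => exact ⟨measurable_const, measurable_const, measurable_const⟩
  | succ t ih =>
    obtain ⟨hv, hm, hx⟩ := ih fun i hi => hξ i (by omega)
    have hgt : Measurable fun ω =>
        g (run p g x₀ (fun i => ξ i ω) t).x (ξ t ω) := hg.comp (hx.prodMk (hξ t (by omega)))
    have hm' : Measurable fun ω => (run p g x₀ (fun i => ξ i ω) (t + 1)).m := by
      simp only [run]
      exact (hm.const_smul p.β).sub (((measurable_stepsize p t).comp hv).smul hgt)
    exact ⟨(hv.const_mul _).add ((hgt.norm.pow_const 2).const_mul _), hm', hx.add hm'⟩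

section Bounds

variable {p : Params} {g : EuclideanSpace ℝ (Fin d) → S → EuclideanSpace ℝ (Fin d)}
  {x₀ : EuclideanSpace ℝ (Fin d)} {ξ : ℕ → S}

theorem stepsize_eq (t : ℕ) (v : ℝ) :
    stepsize p t v = (1 - p.β) / (p.κ + √v) * ((t : ℝ) + 1) ^ (-(1 / 2 + p.ε)) := by
  rw [stepsize, Real.rpow_neg (by positivity), div_mul_eq_div_div, div_right_comm, div_eq_mul_inv]

theorem stepsize_nonneg (hβ₁ : p.β < 1) (hκ : 0 < p.κ) (t : ℕ) (v : ℝ) : 0 ≤ stepsize p t v := by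
  have : 0 < 1 - p.β := by linarith
  rw [stepsize]
  positivity

theorem stepsize_le (hβ₁ : p.β < 1) (hκ : 0 < p.κ) (t : ℕ) (v : ℝ) :
    stepsize p t v ≤ (1 - p.β) / p.κ * ((t : ℝ) + 1) ^ (-(1 / 2 + p.ε)) := by
  have : 0 < 1 - p.β := by linarith
  rw [stepsize_eq]
  gcongr
  exact le_add_of_nonneg_right (Real.sqrt_nonneg _)

theorem le_stepsize (hβ₁ : p.β < 1) (hκ : 0 < p.κ) (t : ℕ) {v G : ℝ} (hG : 0 ≤ G)
    (hv : v ≤ G ^ 2) :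
    (1 - p.β) / (p.κ + G) * ((t : ℝ) + 1) ^ (-(1 / 2 + p.ε)) ≤ stepsize p t v := by
  have : 0 < 1 - p.β := by linarith
  rw [stepsize_eq]
  gcongr
  exact Real.sqrt_le_iff.2 ⟨hG, hv⟩

/-- Each update is a convex combination of `v` and a squared norm at most `G ^ 2`. This keeps the
stepsizes from decaying faster than `(t + 1) ^ (-q)`. -/
theorem run_v_le (hβ'₀ : 0 ≤ p.β') (hβ'₁ : p.β' < 1) {G : ℝ}
    (hg : ∀ t, ‖g (run p g x₀ ξ t).x (ξ t)‖ ≤ G) (t : ℕ) : (run p g x₀ ξ t).v ≤ G ^ 2 := by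
  induction t with
  | zero => exact sq_nonneg G
  | succ t ih =>
    have h1 : ‖g (run p g x₀ ξ t).x (ξ t)‖ ^ 2 ≤ G ^ 2 := pow_le_pow_left₀ (norm_nonneg _) (hg t) 2
    have h2 : 0 ≤ 1 - p.β' := by linarith
    have h3 := mul_le_mul_of_nonneg_left ih hβ'₀
    have h4 := mul_le_mul_of_nonneg_left h1 h2
    simp only [run]
    linarith

end Bounds

/-- The noise accumulated along the trajectory converges almost surely. -/
theorem ae_exists_tendsto_sum_noise {Ω : Type*} {_ : MeasurableSpace Ω} [MeasurableSpace S]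
    {μ : Measure Ω} [IsProbabilityMeasure μ]
    {F : EuclideanSpace ℝ (Fin d) → EuclideanSpace ℝ (Fin d)} (hF : Measurable F)
    {g : EuclideanSpace ℝ (Fin d) → S → EuclideanSpace ℝ (Fin d)}
    (hg : Measurable (Function.uncurry g)) {ξ : ℕ → Ω → S} (hξ : ∀ t, Measurable (ξ t))
    (hξ_indep : iIndepFun ξ μ)
    (hg_unbiased : ∀ t x, Integrable (fun ω => g x (ξ t ω)) μ ∧ ∫ ω, g x (ξ t ω) ∂μ = F x)
    {p : Params} (hβ₁ : p.β < 1) (hκ : 0 < p.κ) (hε : 0 < p.ε)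
    (x₀ : EuclideanSpace ℝ (Fin d)) {G : ℝ} (hG : 0 < G)
    (h_bdd : ∀ t, ∀ᵐ ω ∂μ, ‖F (iterate p g x₀ ξ t ω)‖ ≤ G ∧
      ‖g (iterate p g x₀ ξ t ω) (ξ t ω)‖ ≤ G) :
    ∀ᵐ ω ∂μ, ∃ L : ℝ, Tendsto (fun n => ∑ t ∈ Finset.range n,
      stepsize p t (run p g x₀ (fun i => ξ i ω) t).v *
        inner ℝ (F (iterate p g x₀ ξ t ω))
          (g (iterate p g x₀ ξ t ω) (ξ t ω) - F (iterate p g x₀ ξ t ω))) atTop (𝓝 L) := by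
  have h1β : 0 < 1 - p.β := by linarith
  set ℱ := noiseFiltration ξ hξ
  -- Only the fresh noise `ξ t` becomes a free variable; everything else depends on the `ξ i` with
  -- `i < t`.
  set φ : ℕ → Ω × S → ℝ := fun t a =>
    stepsize p t (run p g x₀ (fun i => ξ i a.1) t).v *
        inner ℝ (F (iterate p g x₀ ξ t a.1))
          (g (iterate p g x₀ ξ t a.1) a.2 - F (iterate p g x₀ ξ t a.1)) with hφ
  have hφm : ∀ t, Measurable[(ℱ t).prod inferInstance] (φ t) := fun t => by
    obtain ⟨hv, -, hx⟩ := @measurable_run d S Ω (ℱ t) _ p g hg x₀ ξ t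
      fun i hi => measurable_noiseFiltration hξ hi
    -- From here measurability on `Ω` refers to the past σ-algebra.
    let _ : MeasurableSpace Ω := ℱ t
    have hx1 : Measurable fun a : Ω × S => iterate p g x₀ ξ t a.1 := hx.comp measurable_fst
    have hv1 : Measurable fun a : Ω × S => (run p g x₀ (fun i => ξ i a.1) t).v :=
      hv.comp measurable_fst
    have hg1 : Measurable fun a : Ω × S => g (iterate p g x₀ ξ t a.1) a.2 :=
      hg.comp (hx1.prodMk measurable_snd)
    have hF1 : Measurable fun a : Ω × S => F (iterate p g x₀ ξ t a.1) := hF.comp hx1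
    exact ((measurable_stepsize p t).comp hv1).mul (hF1.inner (hg1.sub hF1))
  have hYm : ∀ t, StronglyMeasurable[ℱ (t + 1)] fun ω => φ t (ω, ξ t ω) := fun t => by
    have h1 : Measurable[ℱ (t + 1), (ℱ t).prod inferInstance] fun ω => (ω, ξ t ω) :=
      Measurable.prodMk (measurable_id'' (ℱ.mono (Nat.le_succ t)))
        (measurable_noiseFiltration hξ (Nat.lt_succ_self t))
    exact Measurable.stronglyMeasurable ((hφm t).comp h1)
  have hbound : ∀ t : ℕ, ∀ᵐ ω ∂μ, |φ t (ω, ξ t ω)| ≤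
      (1 - p.β) / p.κ * (2 * G ^ 2) * ((t : ℝ) + 1) ^ (-(1 / 2 + p.ε)) := fun t => by
    filter_upwards [h_bdd t] with ω hω
    simp only [hφ]
    rw [abs_mul, abs_of_nonneg (stepsize_nonneg hβ₁ hκ _ _)]
    have h1 : |inner ℝ (F (iterate p g x₀ ξ t ω))
        (g (iterate p g x₀ ξ t ω) (ξ t ω) - F (iterate p g x₀ ξ t ω))| ≤ G * (G + G) :=
      (abs_real_inner_le_norm _ _).trans (mul_le_mul hω.1
        ((norm_sub_le _ _).trans (add_le_add hω.2 hω.1)) (norm_nonneg _) hG.le)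
    refine (mul_le_mul (stepsize_le hβ₁ hκ _ _) h1 (abs_nonneg _) (by positivity)).trans_eq ?_
    ring
  have hYint : ∀ t, Integrable (fun ω => φ t (ω, ξ t ω)) μ := fun t =>
    Integrable.of_bound ((hYm t).mono (ℱ.le _)).aestronglyMeasurable _
      (by simpa only [Real.norm_eq_abs] using hbound t)
  refine ae_exists_tendsto_sum_of_condExp_eq_zero ℱ hYm hbound ?_ fun t =>
    condExp_kernel_eq_zero (ℱ.le t) (hξ t) (indep_noiseFiltration hξ hξ_indep t) (hφm t) (hYint t)
      fun ω => ?_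
  -- The squared bounds have exponent `2 * q = 1 + 2 * ε > 1`.
  · refine ((summable_rpow_neg_add_one (r := (1 / 2 + p.ε) * (2 : ℕ)).2 ?_).mul_left
      (((1 - p.β) / p.κ * (2 * G ^ 2)) ^ 2)).congr fun t => ?_
    · push_cast
      linarith
    · rw [← rpow_neg_rpow, Real.rpow_natCast, mul_pow _ (_ ^ _)]
  · obtain ⟨hint, hmean⟩ := hg_unbiased t (iterate p g x₀ ξ t ω)
    simp only [hφ]
    rw [integral_const_mul, integral_inner (f := fun a => g (iterate p g x₀ ξ t ω) (ξ t a) -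
      F (iterate p g x₀ ξ t ω)) (hint.sub (integrable_const _)),
      integral_sub hint (integrable_const _), hmean]
    simp

end PerturbedAdam

/-! ### Assembly on the almost sure event. -/

theorem mainTheorem4 {Ω S : Type*} [MeasurableSpace Ω] [MeasurableSpace S]
    (μ : Measure Ω) [IsProbabilityMeasure μ] (d : ℕ)
    -- the cost function, of class C^{1+α} and bounded below
    (f : EuclideanSpace ℝ (Fin d) → ℝ) (hf : ContDiff ℝ 1 f) (hf_inf : BddBelow (Set.range f))
    (α : ℝ) (hα₀ : 0 < α) (hα₁ : α ≤ 1) (A : ℝ) (hA : 0 < A)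
    (hf_holder : ∀ x y, ‖gradient f x - gradient f y‖ ≤ A * ‖x - y‖ ^ α)
    -- the oracle: jointly measurable and unbiased; independent noise variables
    (g : EuclideanSpace ℝ (Fin d) → S → EuclideanSpace ℝ (Fin d))
    (hg : Measurable (Function.uncurry g))
    (ξ : ℕ → Ω → S) (hξ : ∀ t, Measurable (ξ t)) (hξ_indep : iIndepFun ξ μ)
    (hg_unbiased : ∀ t x, Integrable (fun ω => g x (ξ t ω)) μ ∧
      ∫ ω, g x (ξ t ω) ∂μ = gradient f x)
    -- the parameters of the algorithm
    (p : PerturbedAdam.Params) (hβ₀ : 0 ≤ p.β) (hβ₁ : p.β < 1) (hβ'₀ : 0 ≤ p.β') (hβ'₁ : p.β' < 1)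
    (hκ : 0 < p.κ) (hε₀ : 1 / (1 + α) - 1 / 2 < p.ε) (hε₁ : p.ε ≤ 1 / 2)
    (x₀ : EuclideanSpace ℝ (Fin d))
    -- boundedness along the trajectory
    (G : ℝ) (hG : 0 < G)
    (h_bdd : ∀ t, ∀ᵐ ω ∂μ, ‖gradient f (PerturbedAdam.iterate p g x₀ ξ t ω)‖ ≤ G ∧
      ‖g (PerturbedAdam.iterate p g x₀ ξ t ω) (ξ t ω)‖ ≤ G) :
    (∀ᵐ ω ∂μ, Tendsto (fun t => gradient f (PerturbedAdam.iterate p g x₀ ξ t ω)) atTop (𝓝 0)) ∧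
    (∀ᵐ ω ∂μ, ∃ L : ℝ,
      Tendsto (fun t => f (PerturbedAdam.iterate p g x₀ ξ t ω)) atTop (𝓝 L)) ∧
    (∀ᵐ ω ∂μ, liminf (fun t : ℕ =>
      (((t : ℝ) ^ ((1 : ℝ) / 2 - p.ε) *
        ‖gradient f (PerturbedAdam.iterate p g x₀ ξ t ω)‖ ^ 2 : ℝ) : EReal)) atTop = 0) := by
  have h1β : 0 < 1 - p.β := by linarith
  have hq : 1 < (1 / 2 + p.ε) * (1 + α) := by
    have h1 : 1 / (1 + α) < 1 / 2 + p.ε := by linarith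
    rwa [div_lt_iff₀ (by linarith)] at h1
  -- As `α ≤ 1`, the lower bound `1 / (1 + α) - 1 / 2` on `ε` is nonnegative.
  have hε : 0 < p.ε := by nlinarith
  have hgrad : Measurable (gradient f) :=
    ((InnerProductSpace.toDual ℝ _).symm.continuous.comp
      (hf.continuous_fderiv one_ne_zero)).measurable
  have hnoise := PerturbedAdam.ae_exists_tendsto_sum_noise hgrad hg hξ hξ_indep hg_unbiased hβ₁ hκ
    hε x₀ hG h_bdd
  have key : ∀ᵐ ω ∂μ,
      Tendsto (fun t => gradient f (PerturbedAdam.iterate p g x₀ ξ t ω)) atTop (𝓝 0) ∧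
      (∃ L : ℝ, Tendsto (fun t => f (PerturbedAdam.iterate p g x₀ ξ t ω)) atTop (𝓝 L)) ∧
      liminf (fun t : ℕ => (((t : ℝ) ^ ((1 : ℝ) / 2 - p.ε) *
        ‖gradient f (PerturbedAdam.iterate p g x₀ ξ t ω)‖ ^ 2 : ℝ) : EReal)) atTop = 0 := by
    filter_upwards [hnoise, ae_all_iff.2 h_bdd] with ω ⟨L, hL⟩ hω
    rw [show (1 : ℝ) / 2 - p.ε = 1 - (1 / 2 + p.ε) by ring]
    exact PerturbedAdam.converges_of_tendsto_sum_noise (hf.differentiable one_ne_zero) hf_inf hA hα₀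
      hf_holder hβ₀ hβ₁ (by linarith) (by linarith) hq (c₀ := (1 - p.β) / (p.κ + G))
      (c₁ := (1 - p.β) / p.κ) (by positivity) (by positivity) hG
      (m := fun t => (PerturbedAdam.run p g x₀ (fun i => ξ i ω) t).m) rfl (fun _ => rfl)
      (fun _ => rfl)
      (fun t => PerturbedAdam.le_stepsize hβ₁ hκ t hG.le
        (PerturbedAdam.run_v_le hβ'₀ hβ'₁ (fun s => (hω s).2) t))
      (fun t => PerturbedAdam.stepsize_le hβ₁ hκ t _) (fun t => (hω t).1) (fun t => (hω t).2) hL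
  exact ⟨key.mono fun _ h => h.1, key.mono fun _ h => h.2.1, key.mono fun _ h => h.2.2⟩
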